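/- Let $S^1=\mathbb R/\mathbb Z$, and call the images of $\mathbb Z[1/2]$ in $S^1$ dyadic points. Let $T$ be Thompson's group $T$: the group of homeomorphisms $g$ of $S^1$ that map the set of dyadic points onto itself and for which there is a finite set $B$ of dyadic points such that, near every point of $S^1\setminus B$, $g$ is affine with slope an integer power of $2$. Let $G(T,S^1)$ be the groupoid of germs of $T\curvearrowright S^1$: its elements are the classes $[g,x]$ of pairs $(g,x)\in T\times S^1$, where $[g,x]=[h,y]$ if and only if $x=y$ and $g,h$ agree on a neighbourhood of $x$; source and range are $s([g,x])=x$ and $r([g,x])=gx$, the product is $[h,gx][g,x]=[hg,x]$, the inverse is $[g,x]^{-1}=[g^{-1},gx]$, and the topology is generated by the sets $\{[g,x]:x\in U\}$ with $g\in T$ and $U\subset S^1$ open. **Theorem.** $G(T,S^1)$ is a second countable étale topological groupoid (its unit space $S^1$ is Hausdorff and $r,s$ are local homeomorphisms), it is not Hausdorff, and it is Borel amenable. The last assertion means, writing $G=G(T,S^1)$, that there is a sequence $(m_n)_{n\in\mathbb N}$, where each $m_n=(m_n^x)_{x\in S^1}$ is a family of probability measures $m_n^x$ on the countable fibres $r^{-1}(x)$,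 such that 1. for all $n$ and all bounded Borel functions $f\colon G\to\mathbb R$, the function $x\mapsto\sum_{g\in r^{-1}(x)}f(g)\,m_n^x(g)$ on $S^1$ is Borel; 2. for all $g\in G$, $\displaystyle\sum_{h\in r^{-1}(r(g))}\bigl|m_n^{s(g)}(g^{-1}h)-m_n^{r(g)}(h)\bigr|\to 0$ as $n\to\infty$. -/

import Mathlib

open Filter Topology MeasureTheory

/-! ### Groupoids, étale groupoids, Borel amenability -/

/-- A groupoid with set of arrows `G` and set of units `X`, with range map `r`, source map `s`,
unit arrows, inverses, and the product `mul g h` of `g, h` defined exactly when `s g = r h`. -/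
class GroupoidOver (G : Type*) (X : outParam Type*) where
  r : G → X
  s : G → X
  unit : X → G
  inv : G → G
  mul : (g h : G) → s g = r h → G
  r_unit : ∀ x, r (unit x) = x
  s_unit : ∀ x, s (unit x) = x
  r_inv : ∀ g, r (inv g) = s g
  s_inv : ∀ g, s (inv g) = r g
  r_mul : ∀ g h (e : s g = r h), r (mul g h e) = r g
  s_mul : ∀ g h (e : s g = r h), s (mul g h e) = s h
  unit_mul : ∀ g, mul (unit (r g)) g (s_unit (r g)) = g
  mul_unit : ∀ g, mul g (unit (s g)) (r_unit (s g)).symm = g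
  inv_mul : ∀ g, mul (inv g) g (s_inv g) = unit (s g)
  mul_inv : ∀ g, mul g (inv g) (r_inv g).symm = unit (r g)
  mul_assoc : ∀ g h k (e₁ : s g = r h) (e₂ : s h = r k),
    mul (mul g h e₁) k ((s_mul g h e₁).trans e₂) = mul g (mul h k e₂) (e₁.trans (r_mul h k e₂).symm)

section

open GroupoidOver

/-- `G` is a topological groupoid with unit space `X`: all structure maps are continuous, where the
product is considered on the subspace of composable pairs of `G × G`. Continuity of `unit` and `r`
(with `r (unit x) = x`) makes `unit` a homeomorphism of `X` onto the subspace of units of `G`. -/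
structure IsTopologicalGroupoid (G X : Type*) [TopologicalSpace G] [TopologicalSpace X]
    [GroupoidOver G X] : Prop where
  continuous_r : Continuous (r : G → X)
  continuous_s : Continuous (s : G → X)
  continuous_unit : Continuous (unit : X → G)
  continuous_inv : Continuous (inv : G → G)
  continuous_mul :
    Continuous fun p : {p : G × G // s p.1 = r p.2} => mul p.1.1 p.1.2 p.2

/-- An étale groupoid: a topological groupoid with Hausdorff unit space whose range and source maps
are local homeomorphisms. The arrow space itself need not be Hausdorff. -/
structure IsEtaleGroupoid (G X : Type*) [TopologicalSpace G] [TopologicalSpace X]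
    [GroupoidOver G X] : Prop extends IsTopologicalGroupoid G X where
  t2_units : T2Space X
  isLocalHomeomorph_r : IsLocalHomeomorph (r : G → X)
  isLocalHomeomorph_s : IsLocalHomeomorph (s : G → X)

/-- Borel amenability of a second countable étale groupoid `G` with unit space `X`. Range fibres are
countable, so a probability measure on `r⁻¹(x)` is given by its point masses: `m n x g` is the mass
that the measure `m_n^x`, which lives on `r⁻¹(x)`, gives to `g`. -/
def IsBorelAmenable (G X : Type*) [TopologicalSpace G] [TopologicalSpace X]
    [GroupoidOver G X] : Prop :=
  ∃ m : ℕ → X → G → ℝ,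
    (∀ n x g, 0 ≤ m n x g) ∧
    (∀ n x g, r g ≠ x → m n x g = 0) ∧
    (∀ n x, HasSum (fun g : {g : G // r g = x} => m n x g) 1) ∧
    (∀ n, ∀ f : G → ℝ, Measurable[borel G] f → (∃ C : ℝ, ∀ g, |f g| ≤ C) →
      Measurable[borel X] fun x => ∑' g : {g : G // r g = x}, f g * m n x g) ∧
    (∀ g : G, Tendsto (fun n => ∑' h : {h : G // r h = r g},
        |m n (s g) (mul (inv g) h ((s_inv g).trans h.2.symm)) - m n (r g) h|) atTop (𝓝 0))

end

/-! ### The groupoid of germs of a group action -/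

/-- The open stabilizer of `x`: the elements of `Γ` that fix a neighbourhood of `x` pointwise. -/
def openStabilizer (Γ : Type*) {X : Type*} [Group Γ] [TopologicalSpace X] [MulAction Γ X]
    (x : X) : Subgroup Γ where
  carrier := {g | ∀ᶠ y in 𝓝 x, g • y = y}
  one_mem' := Eventually.of_forall fun y => one_smul Γ y
  mul_mem' := by
    intro a b ha hb
    filter_upwards [ha, hb] with y h1 h2
    rw [mul_smul, h2, h1]
  inv_mem' := by
    intro a ha
    filter_upwards [ha] with y h1
    rw [inv_smul_eq_iff, h1]

/-- `(g, x) ∼ (h, y)` iff `x = y` and `g Γ_x⁰ = h Γ_x⁰`. -/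
def germSetoid (Γ X : Type*) [Group Γ] [TopologicalSpace X] [MulAction Γ X] :
    Setoid (Γ × X) where
  r p q := p.2 = q.2 ∧
    (p.1 : Γ ⧸ openStabilizer Γ p.2) = (q.1 : Γ ⧸ openStabilizer Γ p.2)
  iseqv :=
    { refl := fun _ => ⟨rfl, rfl⟩
      symm := by
        rintro ⟨g, x⟩ ⟨h, y⟩ ⟨e, e'⟩
        dsimp only at e e'
        subst e
        exact ⟨rfl, e'.symm⟩
      trans := by
        rintro ⟨g, x⟩ ⟨h, y⟩ ⟨k, z⟩ ⟨e, e'⟩ ⟨d, d'⟩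
        dsimp only at e e' d d'
        subst e
        subst d
        exact ⟨rfl, e'.trans d'⟩ }

/-- The set of germs `[g, x]` of the action of `Γ` on `X`. -/
def GermGroupoid (Γ X : Type*) [Group Γ] [TopologicalSpace X] [MulAction Γ X] : Type _ :=
  Quotient (germSetoid Γ X)

namespace GermGroupoid

section

variable {Γ X : Type*} [Group Γ] [TopologicalSpace X] [MulAction Γ X]

/-- The germ `[g, x]` of `g` at `x`. -/
def mk (g : Γ) (x : X) : GermGroupoid Γ X := Quotient.mk (germSetoid Γ X) (g, x)

theorem mk_eq_mk {g h : Γ} {x y : X} :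
    mk g x = mk h y ↔ x = y ∧ ∀ᶠ z in 𝓝 x, g • z = h • z := by
  have h1 : mk g x = mk h y ↔ x = y ∧
      (g : Γ ⧸ openStabilizer Γ x) = (h : Γ ⧸ openStabilizer Γ x) :=
    Quotient.eq (r := germSetoid Γ X)
  rw [h1, QuotientGroup.eq]
  refine and_congr_right fun _ => ?_
  change (∀ᶠ z in 𝓝 x, (g⁻¹ * h) • z = z) ↔ _
  refine eventually_congr (Eventually.of_forall fun z => ?_)
  rw [mul_smul, inv_smul_eq_iff, eq_comm]

theorem mk_out (a : GermGroupoid Γ X) : mk (Quotient.out a).1 (Quotient.out a).2 = a :=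
  Quotient.out_eq a

theorem ind {P : GermGroupoid Γ X → Prop} (h : ∀ g x, P (mk g x)) (a : GermGroupoid Γ X) : P a :=
  Quotient.inductionOn a fun p => h p.1 p.2

/-- The topology generated by the sets `[g, U] = {[g, x] : x ∈ U}` with `U ⊆ X` open. -/
instance : TopologicalSpace (GermGroupoid Γ X) :=
  TopologicalSpace.generateFrom {S | ∃ (g : Γ) (U : Set X), IsOpen U ∧ S = mk g '' U}

/-- The source `x` of `[g, x]`. -/
def src (a : GermGroupoid Γ X) : X :=
  Quotient.liftOn a (fun p => p.2) fun _ _ h => h.1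

/-- The range `g • x` of `[g, x]`. -/
def rng (a : GermGroupoid Γ X) : X :=
  Quotient.liftOn a (fun p => p.1 • p.2) fun p q h => by
    obtain ⟨e, e'⟩ := mk_eq_mk.1 (Quotient.sound h : mk p.1 p.2 = mk q.1 q.2)
    rw [← e]
    exact e'.self_of_nhds

@[simp] theorem src_mk (g : Γ) (x : X) : src (mk g x) = x := rfl

@[simp] theorem rng_mk (g : Γ) (x : X) : rng (mk g x) = g • x := rfl

end

section

variable {Γ X : Type*} [Group Γ] [TopologicalSpace X] [MulAction Γ X] [ContinuousConstSMul Γ X]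

/-- The inverse `[g⁻¹, g • x]` of `[g, x]`. -/
def inverse (a : GermGroupoid Γ X) : GermGroupoid Γ X :=
  Quotient.liftOn a (fun p => mk p.1⁻¹ (p.1 • p.2)) fun p q h => by
    obtain ⟨e, e'⟩ := mk_eq_mk.1 (Quotient.sound h : mk p.1 p.2 = mk q.1 q.2)
    refine mk_eq_mk.2 ⟨e ▸ e'.self_of_nhds, ?_⟩
    have hc : Tendsto (fun z : X => p.1⁻¹ • z) (𝓝 (p.1 • p.2)) (𝓝 p.2) := by
      have := (continuous_const_smul (p.1⁻¹ : Γ) (T := X)).tendsto (p.1 • p.2)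
      rwa [inv_smul_smul] at this
    filter_upwards [hc.eventually e'] with z hz
    rw [smul_inv_smul] at hz
    rw [eq_inv_smul_iff, ← hz]

@[simp] theorem inverse_mk (g : Γ) (x : X) : inverse (mk g x) = mk g⁻¹ (g • x) := rfl

/-- The product of germs, `[h, g • x] [g, x] = [h * g, x]`, see `prod_mk_mk`. -/
noncomputable def prod (a b : GermGroupoid Γ X) (_ : src a = rng b) : GermGroupoid Γ X :=
  mk ((Quotient.out a).1 * (Quotient.out b).1) (src b)

theorem prod_mk_mk (h g : Γ) (y x : X) (e : src (mk h y) = rng (mk g x)) :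
    prod (mk h y) (mk g x) e = mk (h * g) x := by
  simp only [src_mk, rng_mk] at e
  subst e
  obtain ⟨e1, e1'⟩ := mk_eq_mk.1 (mk_out (mk h (g • x)))
  obtain ⟨e2, e2'⟩ := mk_eq_mk.1 (mk_out (mk g x))
  refine mk_eq_mk.2 ⟨rfl, ?_⟩
  rw [src_mk]
  rw [e1] at e1'
  rw [e2] at e2'
  have hc : Tendsto (fun z : X => g • z) (𝓝 x) (𝓝 (g • x)) :=
    (continuous_const_smul g).tendsto x
  filter_upwards [e2', hc.eventually e1'] with z h2 h1
  rw [mul_smul, mul_smul, h2, h1]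

/-- The groupoid of germs, with unit `[1, x]` at `x ∈ X`. -/
noncomputable instance : GroupoidOver (GermGroupoid Γ X) X where
  r := rng
  s := src
  unit x := mk 1 x
  inv := inverse
  mul := prod
  r_unit x := by simp
  s_unit x := by simp
  r_inv := ind fun g x => by simp
  s_inv := ind fun g x => by simp
  r_mul := ind fun h y => ind fun g x => by
    intro e
    rw [prod_mk_mk]
    simp only [src_mk, rng_mk] at e
    simp [mul_smul, e]
  s_mul := ind fun h y => ind fun g x => by
    intro e
    rw [prod_mk_mk, src_mk, src_mk]
  unit_mul := ind fun g x => (prod_mk_mk 1 g (g • x) x rfl).trans (by rw [one_mul])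
  mul_unit := ind fun g x =>
    (prod_mk_mk g 1 x x (one_smul Γ x).symm).trans (by rw [mul_one])
  inv_mul := ind fun g x => by
    simp only [inverse_mk, prod_mk_mk, inv_mul_cancel, src_mk]
  mul_inv := ind fun g x => by
    simp only [inverse_mk, prod_mk_mk, mul_inv_cancel, rng_mk]
  mul_assoc := ind fun g x => ind fun h y => ind fun k z => by
    intro e₁ e₂
    simp only [prod_mk_mk, mul_assoc]

end

end GermGroupoid

/-! ### Thompson's group `T` acting on the circle -/

/-- The image of `ℤ[1/2]` in the circle `ℝ / ℤ`. -/
def dyadicPoints : Set UnitAddCircle :=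
  {x | ∃ (a : ℤ) (n : ℕ), x = ((a / 2 ^ n : ℝ) : UnitAddCircle)}

/-- Thompson's group `T`: the homeomorphisms `g` of the circle `ℝ / ℤ` that preserve the set of
dyadic points and for which there is a finite set `B` of dyadic points such that, around each point
outside `B`, `g` is affine with slope an integer power of `2`. -/
def ThompsonT : Subgroup (UnitAddCircle ≃ₜ UnitAddCircle) where
  carrier := {g | (∀ x, g x ∈ dyadicPoints ↔ x ∈ dyadicPoints) ∧
    ∃ B : Set UnitAddCircle, B.Finite ∧ B ⊆ dyadicPoints ∧ ∀ x ∉ B, ∃ k : ℤ,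
      ∀ᶠ t : ℝ in 𝓝 (0 : ℝ),
        g (x + ((t : ℝ) : UnitAddCircle)) = g x + (((2 : ℝ) ^ k * t : ℝ) : UnitAddCircle)}
  one_mem' := by
    refine ⟨fun x => Iff.rfl, ∅, Set.finite_empty, Set.empty_subset _, fun x _ => ⟨0, ?_⟩⟩
    refine Eventually.of_forall fun t => ?_
    simp
  mul_mem' := by
    rintro g h ⟨hg, A, hA, hAd, hgA⟩ ⟨hh, B, hB, hBd, hhB⟩
    refine ⟨fun x => (hg (h x)).trans (hh x), B ∪ h ⁻¹' A,
      hB.union (hA.preimage h.injective.injOn),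
      Set.union_subset hBd fun x hx => (hh x).1 (hAd hx), fun x hx => ?_⟩
    rw [Set.mem_union, not_or] at hx
    obtain ⟨k, hk⟩ := hhB x hx.1
    obtain ⟨l, hl⟩ := hgA (h x) hx.2
    refine ⟨l + k, ?_⟩
    have hc : Tendsto (fun t : ℝ => (2 : ℝ) ^ k * t) (𝓝 0) (𝓝 0) := by
      simpa using (continuous_const_mul ((2 : ℝ) ^ k)).tendsto 0
    filter_upwards [hk, hc.eventually hl] with t h1 h2
    change g (h (x + t)) = g (h x) + _
    rw [h1, h2, zpow_add₀ two_ne_zero, mul_assoc]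
  inv_mem' := by
    rintro g ⟨hg, A, hA, hAd, hgA⟩
    refine ⟨fun x => ?_, g '' A, hA.image g, ?_, fun y hy => ?_⟩
    · change g.symm x ∈ _ ↔ _
      rw [← hg, g.apply_symm_apply]
    · rintro _ ⟨x, hx, rfl⟩
      exact (hg x).2 (hAd hx)
    · obtain ⟨x, rfl⟩ := g.surjective y
      obtain ⟨k, hk⟩ := hgA x fun hx => hy ⟨x, hx, rfl⟩
      refine ⟨-k, ?_⟩
      have hc : Tendsto (fun t : ℝ => (2 : ℝ) ^ (-k) * t) (𝓝 0) (𝓝 0) := by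
        simpa using (continuous_const_mul ((2 : ℝ) ^ (-k))).tendsto 0
      filter_upwards [hc.eventually hk] with t h1
      rw [← mul_assoc, ← zpow_add₀ two_ne_zero, add_neg_cancel, zpow_zero, one_mul] at h1
      change g.symm (g x + t) = g.symm (g x) + _
      rw [← h1, g.symm_apply_apply, g.symm_apply_apply]

namespace ThompsonT

/-- The action of `T` on the circle by evaluation. -/
instance : MulAction ThompsonT UnitAddCircle where
  smul g x := (g : UnitAddCircle ≃ₜ UnitAddCircle) x
  one_smul _ := rfl
  mul_smul _ _ _ := rfl

theorem smul_def (g : ThompsonT) (x : UnitAddCircle) :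
    g • x = (g : UnitAddCircle ≃ₜ UnitAddCircle) x := rfl

instance : ContinuousConstSMul ThompsonT UnitAddCircle where
  continuous_const_smul g := (g : UnitAddCircle ≃ₜ UnitAddCircle).continuous

end ThompsonT

/-!
The germ groupoid of an action by homeomorphisms is étale because every group element `g` gives an
open embedding `x ↦ [g, x]` of the unit space that is a section of the source map
(`GermGroupoid.isOpenEmbedding_mk`).

A germ of an element of `T` is determined by its source, its range, and its slopes on the left and
on the right (`HasSlopes.mk_eq_mk`), and these slopes add up in exponents under products. A single
element `bend` of `T`, supported on half of the circle, and the dyadic rotations realize all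
possible germs, so that countably many elements of `T` suffice to cover the groupoid, which is
therefore second countable (`exists_mem_bendSubgroup_mk_eq`). On the left of the point `0`, `bend`
is the identity, but not on the right; its germ at `0` and the unit at `0` thus cannot be separated.

For Borel amenability the circle is split into its dyadic and its nondyadic points. The dyadic
points form one orbit with isotropy `ℤ²`, given by the two slopes, and the means are averages over
boxes in `ℤ²`. At nondyadic points the germs are those of the doubling map: the affine pieces of an
element of `T` have dyadic translation parts, so that `x` and `g x` have the same image under
suitable iterates of the doubling map (`HasSlopes.exists_two_pow_smul_eq`). There, the mean at `x`
is the average of the point masses at the germs that lead from the first points of the forward orbit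
of `x` under doubling back to `x`. In both cases the mean averages over a family of germs indexed
by `ℕ²`, and the action of the groupoid eventually translates the index (`exists_prod_ray`), which
changes the averages over large boxes by little (`tendsto_tsum_abs_sub_box`). The germs of the
doubling map depend continuously on `x` and the dyadic points are countable, whence measurability.
-/

/-! ### Charts of the groupoid of germs -/

namespace GermGroupoid

section

variable {Γ X : Type*} [Group Γ] [TopologicalSpace X] [MulAction Γ X]

theorem isOpen_image_mk (g : Γ) {U : Set X} (hU : IsOpen U) :
    IsOpen (mk g '' U : Set (GermGroupoid Γ X)) :=
  TopologicalSpace.isOpen_generateFrom_of_mem ⟨g, U, hU, rfl⟩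

theorem continuous_mk (g : Γ) : Continuous (mk g : X → GermGroupoid Γ X) := by
  refine continuous_generateFrom_iff.2 ?_
  rintro _ ⟨h, U, hU, rfl⟩
  have : mk g ⁻¹' (mk h '' U) = U ∩ {x : X | ∀ᶠ z in 𝓝 x, h • z = g • z} := by
    ext x
    simp only [Set.mem_preimage, Set.mem_image, mk_eq_mk, Set.mem_inter_iff, Set.mem_ofPred_eq]
    constructor
    · rintro ⟨y, hy, rfl, h1⟩
      exact ⟨hy, h1⟩
    · rintro ⟨hx, h1⟩
      exact ⟨x, hx, rfl, h1⟩
  rw [this]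
  exact hU.inter isOpen_setOfPred_eventually_nhds

/-- Every `g : Γ` gives a section of the source map that is open onto its image. These open
embeddings are the charts of the germ groupoid. -/
theorem isOpenEmbedding_mk (g : Γ) : IsOpenEmbedding (mk g : X → GermGroupoid Γ X) :=
  .of_continuous_injective_isOpenMap (continuous_mk g) (fun _ _ h => (mk_eq_mk.1 h).1)
    fun _ hU => isOpen_image_mk g hU

theorem continuous_of_comp_mk {Y : Type*} [TopologicalSpace Y] {f : GermGroupoid Γ X → Y}
    (h : ∀ g : Γ, Continuous fun x => f (mk g x)) : Continuous f :=
  continuous_iff_continuousAt.2 <| ind fun g _ =>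
    ((isOpenEmbedding_mk g).continuousAt_iff (f := mk g) (g := f)).1 (h g).continuousAt

theorem continuous_src : Continuous (src : GermGroupoid Γ X → X) :=
  continuous_of_comp_mk fun _ => continuous_id

theorem isLocalHomeomorph_src : IsLocalHomeomorph (src : GermGroupoid Γ X → X) := by
  refine IsLocalHomeomorph.mk _ <| ind fun g x => ?_
  have : Nonempty X := ⟨x⟩
  refine ⟨((isOpenEmbedding_mk g).toOpenPartialHomeomorph (mk g)).symm, by simp, ?_⟩
  intro a ha
  obtain ⟨y, rfl⟩ : a ∈ Set.range (mk g : X → GermGroupoid Γ X) := by simpa using ha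
  exact (((isOpenEmbedding_mk g).toOpenPartialHomeomorph_left_inv _).symm)

theorem secondCountableTopology_of_countable_cover [SecondCountableTopology X] {S : Set Γ}
    (hS : S.Countable) (h : ∀ (g : Γ) (x : X), ∃ k ∈ S, mk g x = mk k x) :
    SecondCountableTopology (GermGroupoid Γ X) := by
  have := hS.to_subtype
  have (k : S) : SecondCountableTopology (Set.range (mk (k : Γ) : X → GermGroupoid Γ X)) :=
    (isOpenEmbedding_mk (k : Γ)).toIsEmbedding.toHomeomorph.symm.isInducing.secondCountableTopology
  refine TopologicalSpace.secondCountableTopology_of_countable_cover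
    (U := fun k : S => Set.range (mk (k : Γ) : X → GermGroupoid Γ X))
    (fun k => (isOpenEmbedding_mk (k : Γ)).isOpen_range) (Set.eq_univ_of_forall ?_)
  refine ind fun g x => ?_
  obtain ⟨k, hk, e⟩ := h g x
  exact Set.mem_iUnion.2 ⟨⟨k, hk⟩, x, e.symm⟩

end

section

variable {Γ X : Type*} [Group Γ] [TopologicalSpace X] [MulAction Γ X] [ContinuousConstSMul Γ X]

theorem continuous_inverse : Continuous (inverse : GermGroupoid Γ X → GermGroupoid Γ X) :=
  continuous_of_comp_mk fun g => (continuous_mk g⁻¹).comp (continuous_const_smul g)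

theorem continuous_prod : Continuous
    fun p : {p : GermGroupoid Γ X × GermGroupoid Γ X // src p.1 = rng p.2} =>
      prod p.1.1 p.1.2 p.2 := by
  refine continuous_iff_continuousAt.2 ?_
  rintro ⟨⟨a, b⟩, e⟩
  induction a using ind with | h h y
  induction b using ind with | h g x
  -- On the open set where both factors lie in the charts of `h` and `g`, the product is
  -- `[h * g, src b]`.
  have hev : ∀ᶠ p : {p : GermGroupoid Γ X × GermGroupoid Γ X // src p.1 = rng p.2} in
      𝓝 ⟨(mk h y, mk g x), e⟩, mk (h * g) (src p.1.2) = prod p.1.1 p.1.2 p.2 := by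
    have ho := ((isOpenEmbedding_mk (X := X) h).isOpen_range.prod
      (isOpenEmbedding_mk (X := X) g).isOpen_range).preimage
      (continuous_subtype_val (p := fun p : GermGroupoid Γ X × GermGroupoid Γ X =>
        src p.1 = rng p.2))
    filter_upwards [ho.mem_nhds ⟨⟨y, rfl⟩, ⟨x, rfl⟩⟩]
    rintro ⟨⟨_, _⟩, e⟩ ⟨⟨y, rfl⟩, ⟨x, rfl⟩⟩
    exact (prod_mk_mk h g y x e).symm
  refine ContinuousAt.congr ?_ hev
  exact ((continuous_mk (h * g)).comp
    (continuous_src.comp (continuous_snd.comp continuous_subtype_val))).continuousAt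

/-- The inversion of germs, as a homeomorphism. -/
def inverseHomeomorph : GermGroupoid Γ X ≃ₜ GermGroupoid Γ X where
  toFun := inverse
  invFun := inverse
  left_inv := ind fun g x => by simp
  right_inv := ind fun g x => by simp
  continuous_toFun := continuous_inverse
  continuous_invFun := continuous_inverse

theorem isLocalHomeomorph_rng : IsLocalHomeomorph (rng : GermGroupoid Γ X → X) := by
  have : (rng : GermGroupoid Γ X → X) = src ∘ inverseHomeomorph :=
    funext <| ind fun g x => rfl
  rw [this]
  exact isLocalHomeomorph_src.comp inverseHomeomorph.isLocalHomeomorph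

theorem isEtaleGroupoid [T2Space X] : IsEtaleGroupoid (GermGroupoid Γ X) X where
  continuous_r := isLocalHomeomorph_rng.continuous
  continuous_s := continuous_src
  continuous_unit := continuous_mk 1
  continuous_inv := continuous_inverse
  continuous_mul := continuous_prod
  t2_units := inferInstance
  isLocalHomeomorph_r := isLocalHomeomorph_rng
  isLocalHomeomorph_s := isLocalHomeomorph_src

end

end GermGroupoid

/-! ### Averages over boxes -/

theorem hasSum_sum_pointMass {ι α : Type*} [DecidableEq α] (Q : Finset ι) (w : ι → α) (c : ℝ)
    (f : α → ℝ) :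
    HasSum (fun h => f h * ∑ q ∈ Q, if w q = h then c else 0) (∑ q ∈ Q, f (w q) * c) := by
  simp_rw [Finset.mul_sum]
  refine hasSum_sum fun q _ => ?_
  convert hasSum_ite_eq (w q) (f (w q) * c) using 2 with h
  split_ifs with h1 h2 h2 <;> simp_all

/-- The box `[0, N) × [0, N)`, whose growth makes the averages over it asymptotically invariant
under translations. -/
abbrev box (N : ℕ) : Finset (ℕ × ℕ) := Finset.range N ×ˢ Finset.range N

theorem card_box (N : ℕ) : ((box N).card : ℝ) = (N : ℝ) ^ 2 := by
  simp [box, Finset.card_product, sq]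

theorem sum_box_shift_le {α : Type*} [DecidableEq α] (u : ℕ × ℕ → α) (v : ℕ × ℕ) {K N : ℕ}
    (h1 : K + v.1 ≤ N) (h2 : K + v.2 ≤ N) {c : ℝ} (hc : 0 ≤ c) (h : α) :
    (∑ p ∈ box K, if u (v + p) = h then c else 0) ≤ ∑ p ∈ box N, if u p = h then c else 0 := by
  refine (Finset.sum_map (box K) (addLeftEmbedding v) fun p =>
    if u p = h then c else 0).symm.le.trans ?_
  refine Finset.sum_le_sum_of_subset_of_nonneg ?_ fun p _ _ => by positivity
  intro p hp
  obtain ⟨q, hq, rfl⟩ := Finset.mem_map.1 hp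
  simp only [box, Finset.mem_product, Finset.mem_range, addLeftEmbedding_apply, Prod.fst_add,
    Prod.snd_add] at hq ⊢
  omega

/-- If two `ℕ²`-indexed families of points agree up to a translation of the index, then the
uniform averages of their point masses over large boxes are close in `ℓ¹`: both averages dominate
the average over a slightly smaller box that they have in common. -/
theorem tendsto_tsum_abs_sub_box {α : Type*} [DecidableEq α] (u v : ℕ × ℕ → α) (a b : ℕ × ℕ)
    (huv : ∀ p, u (a + p) = v (b + p)) :
    Tendsto (fun n : ℕ => ∑' h, |(∑ p ∈ box (n + 1), if u p = h then ((n : ℝ) + 1)⁻¹ ^ 2 else 0) -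
      ∑ p ∈ box (n + 1), if v p = h then ((n : ℝ) + 1)⁻¹ ^ 2 else 0|) atTop (𝓝 0) := by
  set M := a.1 + a.2 + b.1 + b.2 with hM
  have hlim : Tendsto (fun n : ℕ => 2 - 2 * (1 - (M : ℝ) * ((n : ℝ) + 1)⁻¹) ^ 2) atTop (𝓝 0) := by
    have h0 : Tendsto (fun n : ℕ => ((n : ℝ) + 1)⁻¹) atTop (𝓝 0) := by
      simpa using tendsto_one_div_add_atTop_nhds_zero_nat (𝕜 := ℝ)
    have := (((h0.const_mul (M : ℝ)).const_sub 1).pow 2).const_mul 2 |>.const_sub 2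
    simpa using this
  refine tendsto_of_tendsto_of_tendsto_of_le_of_le' tendsto_const_nhds hlim
    (Eventually.of_forall fun n => tsum_nonneg fun h => abs_nonneg _) ?_
  filter_upwards [eventually_ge_atTop M] with n hn
  set c : ℝ := ((n : ℝ) + 1)⁻¹ ^ 2 with hc
  have hc0 : 0 ≤ c := by positivity
  have hs (Q : Finset (ℕ × ℕ)) (w : ℕ × ℕ → α) :
      HasSum (fun h => ∑ q ∈ Q, if w q = h then c else 0) (Q.card * c) := by
    simpa using hasSum_sum_pointMass Q w c fun _ => 1
  have hK : ((n + 1 - M : ℕ) : ℝ) = (n : ℝ) + 1 - M := by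
    rw [Nat.cast_sub (by omega)]; push_cast; ring
  have hu := hs (box (n + 1)) u
  have hv := hs (box (n + 1)) v
  have hw := hs (box (n + 1 - M)) fun p => u (a + p)
  have hT := (hu.sub hw).add (hv.sub hw)
  have hle (h : α) : |(∑ p ∈ box (n + 1), if u p = h then c else 0) -
      ∑ p ∈ box (n + 1), if v p = h then c else 0| ≤
      ((∑ p ∈ box (n + 1), if u p = h then c else 0) -
        ∑ p ∈ box (n + 1 - M), if u (a + p) = h then c else 0) +
      ((∑ p ∈ box (n + 1), if v p = h then c else 0) -
        ∑ p ∈ box (n + 1 - M), if u (a + p) = h then c else 0) := by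
    have h1 := sum_box_shift_le u a (K := n + 1 - M) (N := n + 1) (by omega) (by omega) hc0 h
    have h2 := sum_box_shift_le v b (K := n + 1 - M) (N := n + 1) (by omega) (by omega) hc0 h
    simp_rw [← huv] at h2
    rw [abs_le]
    constructor <;> linarith
  refine (Summable.tsum_le_tsum hle (.of_nonneg_of_le (fun _ => abs_nonneg _) hle hT.summable)
    hT.summable).trans (le_of_eq ?_)
  rw [hT.tsum_eq, card_box, card_box, hK, hc]
  have : (n : ℝ) + 1 ≠ 0 := by positivity
  push_cast
  field_simp
  ring

/-! ### Dyadic points -/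

theorem eventually_nhds_iff_add_coe {x : UnitAddCircle} {P : UnitAddCircle → Prop} :
    (∀ᶠ y in 𝓝 x, P y) ↔ ∀ᶠ t : ℝ in 𝓝 0, P (x + (t : UnitAddCircle)) := by
  have h0 : 𝓝 (0 : UnitAddCircle) = map ((↑) : ℝ → UnitAddCircle) (𝓝 0) :=
    QuotientAddGroup.nhds_eq _ (0 : ℝ)
  rw [← map_add_left_nhds_zero x, h0, map_map, eventually_map]
  rfl

theorem eq_zero_of_coe_eq_zero {r : ℝ} (hr : |r| < 1) (h : (r : UnitAddCircle) = 0) : r = 0 := by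
  obtain ⟨n, hn⟩ := (AddCircle.coe_eq_zero_iff (1 : ℝ)).1 h
  have hn' : (n : ℝ) = r := by simpa using hn
  rw [← hn'] at hr ⊢
  have : |n| < 1 := by exact_mod_cast hr
  simp [Int.abs_lt_one_iff.1 this]

theorem eq_zero_of_eventually_coe_mul_eq_zero {a : ℝ}
    (h : ∀ᶠ t : ℝ in 𝓝[>] 0, ((a * t : ℝ) : UnitAddCircle) = 0) : a = 0 := by
  have hc : Tendsto (fun t : ℝ => |a * t|) (𝓝[>] 0) (𝓝 0) := by
    have : Continuous fun t : ℝ => |a * t| := by fun_prop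
    simpa using (this.tendsto 0).mono_left nhdsWithin_le_nhds
  obtain ⟨t, h1, h2, h3⟩ :=
    (h.and ((hc.eventually (gt_mem_nhds one_pos)).and self_mem_nhdsWithin)).exists
  have h3 : 0 < t := h3
  exact (mul_eq_zero.1 (eq_zero_of_coe_eq_zero h2 h1)).resolve_right h3.ne'

theorem coe_two_pow_mul (n : ℕ) (r : ℝ) :
    ((2 ^ n * r : ℝ) : UnitAddCircle) = (2 ^ n : ℕ) • (r : UnitAddCircle) := by
  rw [← AddCircle.coe_nsmul, nsmul_eq_mul]
  push_cast
  rfl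

theorem mem_dyadicPoints_iff {x : UnitAddCircle} : x ∈ dyadicPoints ↔ ∃ n : ℕ, (2 ^ n) • x = 0 := by
  obtain ⟨r, rfl⟩ := QuotientAddGroup.mk_surjective x
  constructor
  · rintro ⟨a, n, h⟩
    refine ⟨n, ?_⟩
    rw [h, ← coe_two_pow_mul, mul_div_cancel₀ _ (by positivity)]
    exact (AddCircle.coe_eq_zero_iff (1 : ℝ)).2 ⟨a, by simp⟩
  · rintro ⟨n, h⟩
    obtain ⟨a, ha⟩ := (AddCircle.coe_eq_zero_iff (1 : ℝ)).1 ((coe_two_pow_mul n r).trans h)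
    refine ⟨a, n, congrArg _ ?_⟩
    rw [eq_div_iff (by positivity), mul_comm, ← ha]
    simp

theorem countable_dyadicPoints : dyadicPoints.Countable := by
  refine (Set.countable_range fun p : ℤ × ℕ => ((p.1 / 2 ^ p.2 : ℝ) : UnitAddCircle)).mono ?_
  rintro x ⟨a, n, rfl⟩
  exact ⟨(a, n), rfl⟩

theorem add_mem_dyadicPoints {x y : UnitAddCircle} (hx : x ∈ dyadicPoints)
    (hy : y ∈ dyadicPoints) : x + y ∈ dyadicPoints := by
  rw [mem_dyadicPoints_iff] at *
  obtain ⟨n, hn⟩ := hx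
  obtain ⟨m, hm⟩ := hy
  refine ⟨n + m, ?_⟩
  rw [smul_add, pow_add, mul_smul, mul_smul, hm, smul_comm, hn]
  simp

theorem neg_mem_dyadicPoints {x : UnitAddCircle} (hx : x ∈ dyadicPoints) :
    -x ∈ dyadicPoints := by
  rw [mem_dyadicPoints_iff] at *
  obtain ⟨n, hn⟩ := hx
  exact ⟨n, by rw [smul_neg, hn, neg_zero]⟩

theorem coe_half_mem_dyadicPoints {r : ℝ} (hr : (r : UnitAddCircle) ∈ dyadicPoints) :
    ((r / 2 : ℝ) : UnitAddCircle) ∈ dyadicPoints := by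
  rw [mem_dyadicPoints_iff] at *
  obtain ⟨n, hn⟩ := hr
  refine ⟨n + 1, ?_⟩
  rw [← coe_two_pow_mul, pow_succ, mul_assoc, mul_div_cancel₀ _ two_ne_zero, coe_two_pow_mul, hn]

theorem coe_double_mem_dyadicPoints {r : ℝ} (hr : (r : UnitAddCircle) ∈ dyadicPoints) :
    ((2 * r : ℝ) : UnitAddCircle) ∈ dyadicPoints := by
  rw [two_mul]
  exact add_mem_dyadicPoints hr hr

theorem exists_dyadic_btwn {u v : ℝ} (h : u < v) :
    ∃ q : ℝ, u < q ∧ q < v ∧ (q : UnitAddCircle) ∈ dyadicPoints := by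
  obtain ⟨n, hn⟩ := exists_pow_lt_of_lt_one (sub_pos.2 h) (by norm_num : (1 / 2 : ℝ) < 1)
  have h2 : (0 : ℝ) < 2 ^ n := by positivity
  rw [one_div, inv_pow, inv_lt_iff_one_lt_mul₀ h2] at hn
  refine ⟨((⌊u * 2 ^ n⌋ + 1 : ℤ) : ℝ) / 2 ^ n, ?_, ?_, _, n, rfl⟩
  · rw [lt_div_iff₀ h2]
    push_cast
    exact Int.lt_floor_add_one _
  · rw [div_lt_iff₀ h2]
    push_cast
    linarith [Int.floor_le (u * 2 ^ n)]

/-! ### One-sided slopes -/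

/-- The germ at `0` of a piecewise linear function with slope `2 ^ k` on the left and `2 ^ l` on
the right. -/
noncomputable def twoSlope (k l : ℤ) (t : ℝ) : ℝ := if t ≤ 0 then 2 ^ k * t else 2 ^ l * t

theorem twoSlope_self (k : ℤ) (t : ℝ) : twoSlope k k t = 2 ^ k * t := ite_self _

theorem twoSlope_of_nonpos (k l : ℤ) {t : ℝ} (ht : t ≤ 0) : twoSlope k l t = 2 ^ k * t := if_pos ht

theorem twoSlope_of_nonneg (k l : ℤ) {t : ℝ} (ht : 0 ≤ t) : twoSlope k l t = 2 ^ l * t := by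
  rcases ht.eq_or_lt with rfl | h
  · simp [twoSlope]
  · exact if_neg h.not_ge

theorem twoSlope_twoSlope (k l k' l' : ℤ) (t : ℝ) :
    twoSlope k' l' (twoSlope k l t) = twoSlope (k' + k) (l' + l) t := by
  rcases le_total t 0 with ht | ht
  · rw [twoSlope_of_nonpos k l ht, twoSlope_of_nonpos _ _ ht,
      twoSlope_of_nonpos _ _ (mul_nonpos_of_nonneg_of_nonpos (by positivity) ht),
      zpow_add₀ two_ne_zero, mul_assoc]
  · rw [twoSlope_of_nonneg k l ht, twoSlope_of_nonneg _ _ ht,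
      twoSlope_of_nonneg _ _ (by positivity), zpow_add₀ two_ne_zero, mul_assoc]

theorem tendsto_twoSlope (k l : ℤ) : Tendsto (twoSlope k l) (𝓝 0) (𝓝 0) := by
  have : Continuous (twoSlope k l) :=
    Continuous.if_le (by fun_prop) (by fun_prop) continuous_id continuous_const (by simp)
  simpa [twoSlope] using this.tendsto 0

namespace ThompsonT

/-- `g` has slope `2 ^ k` on the left and `2 ^ l` on the right of `x`. -/
def HasSlopes (g : ThompsonT) (x : UnitAddCircle) (k l : ℤ) : Prop :=
  ∀ᶠ t : ℝ in 𝓝 0, g • (x + (t : UnitAddCircle)) = g • x + (twoSlope k l t : ℝ)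

theorem HasSlopes.one (x : UnitAddCircle) : HasSlopes 1 x 0 0 :=
  Eventually.of_forall fun t => by simp [twoSlope]

theorem HasSlopes.mul {g h : ThompsonT} {x : UnitAddCircle} {k l k' l' : ℤ}
    (hh : HasSlopes h (g • x) k' l') (hg : HasSlopes g x k l) :
    HasSlopes (h * g) x (k' + k) (l' + l) := by
  filter_upwards [hg, (tendsto_twoSlope k l).eventually hh] with t h1 h2
  rw [mul_smul, mul_smul, h1, h2, twoSlope_twoSlope]

theorem HasSlopes.inv {g : ThompsonT} {x : UnitAddCircle} {k l : ℤ} (hg : HasSlopes g x k l) :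
    HasSlopes g⁻¹ (g • x) (-k) (-l) := by
  filter_upwards [(tendsto_twoSlope (-k) (-l)).eventually hg] with t h1
  rw [twoSlope_twoSlope, add_neg_cancel, add_neg_cancel, twoSlope_self, zpow_zero, one_mul] at h1
  rw [← h1, inv_smul_smul, inv_smul_smul]

/-- A germ of an element of `T` is determined by its source, its range and its two slopes. -/
theorem HasSlopes.mk_eq_mk {g h : ThompsonT} {x : UnitAddCircle} {k l : ℤ}
    (hg : HasSlopes g x k l) (hh : HasSlopes h x k l) (e : g • x = h • x) :
    GermGroupoid.mk g x = GermGroupoid.mk h x := by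
  refine GermGroupoid.mk_eq_mk.2 ⟨rfl, eventually_nhds_iff_add_coe.2 ?_⟩
  filter_upwards [hg, hh] with t h1 h2
  rw [h1, h2, e]

theorem smul_mem_dyadicPoints_iff (g : ThompsonT) (x : UnitAddCircle) :
    g • x ∈ dyadicPoints ↔ x ∈ dyadicPoints := g.2.1 x

theorem exists_hasSlopes_self (g : ThompsonT) {x : UnitAddCircle} (hx : x ∉ dyadicPoints) :
    ∃ k, HasSlopes g x k k := by
  obtain ⟨B, -, hBd, h⟩ := g.2.2
  obtain ⟨k, hk⟩ := h x fun hxB => hx (hBd hxB)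
  refine ⟨k, ?_⟩
  filter_upwards [hk] with t ht
  rw [twoSlope_self]
  exact ht

/-- An element of `T` is affine on every arc without breakpoints: being locally equal to a given
affine map is an open condition, and different affine maps agree nowhere locally. -/
theorem exists_affine_of_isPreconnected (g : ThompsonT) (x : UnitAddCircle) {S : Set ℝ}
    (hS : IsPreconnected S) (hne : S.Nonempty)
    (h : ∀ t ∈ S, ∃ k : ℤ, ∀ᶠ s : ℝ in 𝓝 0, g • (x + (t : UnitAddCircle) + (s : UnitAddCircle)) =
      g • (x + (t : UnitAddCircle)) + (((2 : ℝ) ^ k * s : ℝ) : UnitAddCircle)) :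
    ∃ (k : ℤ) (c : UnitAddCircle), ∀ t ∈ S,
      g • (x + (t : UnitAddCircle)) = c + (((2 : ℝ) ^ k * t : ℝ) : UnitAddCircle) := by
  let U : ℤ × UnitAddCircle → Set ℝ := fun p => {t : ℝ | ∀ᶠ s : ℝ in 𝓝 t,
    g • (x + (s : UnitAddCircle)) = p.2 + (((2 : ℝ) ^ p.1 * s : ℝ) : UnitAddCircle)}
  have hUo (p) : IsOpen (U p) := isOpen_setOfPred_eventually_nhds
  have hcov (t : ℝ) (ht : t ∈ S) : ∃ p, t ∈ U p := by
    obtain ⟨k, hk⟩ := h t ht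
    refine ⟨(k, g • (x + (t : UnitAddCircle)) - (((2 : ℝ) ^ k * t : ℝ) : UnitAddCircle)), ?_⟩
    have hc : Tendsto (fun s : ℝ => s - t) (𝓝 t) (𝓝 0) := by
      simpa using (continuous_sub_right t).tendsto t
    refine (hc.eventually hk).mono fun s hs => ?_
    have e1 : x + (t : UnitAddCircle) + ((s - t : ℝ) : UnitAddCircle) = x + s := by
      rw [AddCircle.coe_sub]; abel
    rw [e1] at hs
    rw [hs, mul_sub, AddCircle.coe_sub, sub_add_eq_add_sub, add_sub_assoc]
  have hdisj (p q) (t : ℝ) (hp : t ∈ U p) (hq : t ∈ U q) : p = q := by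
    obtain ⟨k, c⟩ := p
    obtain ⟨l, d⟩ := q
    have hpq : ∀ᶠ s : ℝ in 𝓝 t, c + (((2 : ℝ) ^ k * s : ℝ) : UnitAddCircle) =
        d + (((2 : ℝ) ^ l * s : ℝ) : UnitAddCircle) := by
      filter_upwards [hp, hq] with s h1 h2
      exact h1.symm.trans h2
    have ht := hpq.self_of_nhds
    have hc : Tendsto (fun s : ℝ => t + s) (𝓝[>] 0) (𝓝 t) := by
      simpa using ((continuous_const_add t).tendsto 0).mono_left nhdsWithin_le_nhds
    have hkl : (2 : ℝ) ^ k - 2 ^ l = 0 := by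
      refine eq_zero_of_eventually_coe_mul_eq_zero ?_
      filter_upwards [hc.eventually hpq] with s hs
      rw [mul_add, mul_add, AddCircle.coe_add, AddCircle.coe_add, ← add_assoc, ← add_assoc, ht,
        add_right_inj] at hs
      rw [sub_mul, AddCircle.coe_sub, hs, sub_self]
    have hkl' : k = l := zpow_right_injective₀ two_pos (by norm_num) (sub_eq_zero.1 hkl)
    subst hkl'
    rw [add_left_inj] at ht
    rw [ht]
  obtain ⟨t₀, ht₀⟩ := hne
  obtain ⟨p, hp⟩ := hcov t₀ ht₀
  have hsub : S ⊆ U p := by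
    refine hS.subset_left_of_subset_union (hUo p) (isOpen_iUnion fun q : {q // q ≠ p} => hUo q)
      ?_ ?_ ⟨t₀, ht₀, hp⟩
    · refine Set.disjoint_left.2 fun t h1 h2 => ?_
      obtain ⟨⟨q, hq⟩, h2⟩ := Set.mem_iUnion.1 h2
      exact hq (hdisj _ _ t h2 h1)
    · intro t ht
      obtain ⟨q, hq⟩ := hcov t ht
      by_cases hqp : q = p
      · exact Or.inl (hqp ▸ hq)
      · exact Or.inr (Set.mem_iUnion.2 ⟨⟨q, hqp⟩, hq⟩)
  refine ⟨p.1, p.2, fun t ht => ?_⟩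
  have ht' : ∀ᶠ s : ℝ in 𝓝 t,
      g • (x + (s : UnitAddCircle)) = p.2 + (((2 : ℝ) ^ p.1 * s : ℝ) : UnitAddCircle) := hsub ht
  exact ht'.self_of_nhds

/-- An element of `T` has one-sided slopes at every point, the breakpoints included. -/
theorem exists_hasSlopes (g : ThompsonT) (x : UnitAddCircle) : ∃ k l, HasSlopes g x k l := by
  obtain ⟨B, hB, -, h⟩ := g.2.2
  have h1 : ∀ᶠ t : ℝ in 𝓝 0, x + (t : UnitAddCircle) ∉ B \ {x} := by
    refine eventually_nhds_iff_add_coe (P := fun y => y ∉ B \ {x}).1 ?_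
    exact (hB.sdiff (t := {x})).isClosed.isOpen_compl.mem_nhds fun h => h.2 rfl
  obtain ⟨ε, hε, hball⟩ := Metric.eventually_nhds_iff.1 (h1.and (Metric.ball_mem_nhds 0 one_pos))
  have hnot (t : ℝ) (ht : t ≠ 0) (htε : |t| < ε) : x + (t : UnitAddCircle) ∉ B := by
    obtain ⟨h2, h3⟩ := hball (y := t) (by simpa using htε)
    refine fun h4 => h2 ⟨h4, fun h5 => ht (eq_zero_of_coe_eq_zero (by simpa using h3) ?_)⟩
    simpa using h5
  -- The constant term on either side is the value at `x`, by continuity.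
  have hlim {k : ℤ} {c : UnitAddCircle} {F : Filter ℝ} [F.NeBot] (hF : F ≤ 𝓝 0)
      (hc : ∀ᶠ t : ℝ in F, g • (x + (t : UnitAddCircle)) =
        c + (((2 : ℝ) ^ k * t : ℝ) : UnitAddCircle)) :
      c = g • x := by
    have hcoe : Continuous ((↑) : ℝ → UnitAddCircle) := AddCircle.continuous_mk' 1
    have c1 : Continuous fun t : ℝ => g • (x + (t : UnitAddCircle)) :=
      (continuous_const_smul g).comp (continuous_const.add hcoe)
    have c2 : Continuous fun t : ℝ => c + (((2 : ℝ) ^ k * t : ℝ) : UnitAddCircle) :=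
      continuous_const.add (hcoe.comp (continuous_const_mul _))
    have t1 := (c1.tendsto 0).mono_left hF
    have t2 := (c2.tendsto 0).mono_left hF
    simpa using tendsto_nhds_unique_of_eventuallyEq t2 t1 (hc.mono fun _ h => h.symm)
  obtain ⟨l, c, hl⟩ := exists_affine_of_isPreconnected g x (S := Set.Ioo 0 ε) isPreconnected_Ioo
    (Set.nonempty_Ioo.2 hε) fun t ht => h _ (hnot t ht.1.ne' (abs_lt.2 ⟨by linarith [ht.1], ht.2⟩))
  obtain ⟨k, d, hk⟩ := exists_affine_of_isPreconnected g x (S := Set.Ioo (-ε) 0) isPreconnected_Ioo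
    (Set.nonempty_Ioo.2 (by linarith)) fun t ht =>
      h _ (hnot t ht.2.ne (abs_lt.2 ⟨ht.1, by linarith [ht.2]⟩))
  obtain rfl := hlim (F := 𝓝[>] 0) nhdsWithin_le_nhds
    (mem_of_superset (Ioo_mem_nhdsGT hε) hl)
  obtain rfl := hlim (F := 𝓝[<] 0) nhdsWithin_le_nhds
    (mem_of_superset (Ioo_mem_nhdsLT (by linarith)) hk)
  refine ⟨k, l, ?_⟩
  filter_upwards [Ioo_mem_nhds (by linarith : -ε < 0) hε] with t ht
  rcases lt_trichotomy t 0 with h0 | rfl | h0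
  · rw [twoSlope_of_nonpos _ _ h0.le, hk t ⟨ht.1, h0⟩]
  · simp [twoSlope]
  · rw [twoSlope_of_nonneg _ _ h0.le, hl t ⟨h0, ht.2⟩]

/-- Where `g` is affine, its graph is contained in an orbit of the doubling map: `g` maps dyadic
points near `x` to dyadic points, so its translation part is dyadic as well and is killed by
doubling often enough. -/
theorem HasSlopes.exists_two_pow_smul_eq {g : ThompsonT} {x : UnitAddCircle} {k : ℤ}
    (hg : HasSlopes g x k k) :
    ∃ a b : ℕ, ((a : ℤ) - b = k) ∧ ∀ i : ℕ, (2 ^ (a + i)) • x = (2 ^ (b + i)) • g • x := by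
  obtain ⟨ε, hε, hball⟩ := Metric.eventually_nhds_iff.1 hg
  obtain ⟨r, rfl⟩ := QuotientAddGroup.mk_surjective x
  obtain ⟨q, hq1, hq2, hq⟩ := exists_dyadic_btwn (lt_add_of_pos_right r hε)
  have h1 := hball (y := q - r) (by
    rw [dist_zero_right, Real.norm_eq_abs, abs_lt]; constructor <;> linarith)
  rw [twoSlope_self] at h1
  set t : ℝ := q - r
  set x : UnitAddCircle := QuotientAddGroup.mk r
  have hxt : x + (t : UnitAddCircle) = q := by
    change ((r : ℝ) : UnitAddCircle) + _ = _
    rw [← AddCircle.coe_add, add_sub_cancel]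
  have hd : g • (x + (t : UnitAddCircle)) ∈ dyadicPoints := by
    rwa [smul_mem_dyadicPoints_iff, hxt]
  rw [h1] at hd
  rw [← hxt] at hq
  obtain ⟨n, hn⟩ := mem_dyadicPoints_iff.1 hq
  obtain ⟨m, hm⟩ := mem_dyadicPoints_iff.1 hd
  refine ⟨k.toNat + (n + m), (-k).toNat + (n + m), by omega, fun i => ?_⟩
  set a := k.toNat + (n + m) + i with ha
  set b := (-k).toNat + (n + m) + i with hb
  have hn' : (2 ^ a) • (x + (t : UnitAddCircle)) = 0 := by
    rw [show a = (k.toNat + m + i) + n by omega, pow_add, mul_smul, hn, smul_zero]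
  have hm' : (2 ^ b) • (g • x + (((2 : ℝ) ^ k * t : ℝ) : UnitAddCircle)) = 0 := by
    rw [show b = ((-k).toNat + n + i) + m by omega, pow_add, mul_smul, hm, smul_zero]
  have hab : (2 : ℝ) ^ b * (2 ^ k * t) = 2 ^ a * t := by
    rw [← mul_assoc, ← zpow_natCast, ← zpow_natCast, ← zpow_add₀ two_ne_zero]
    congr 2
    omega
  rw [smul_add, ← coe_two_pow_mul, hab] at hm'
  rw [smul_add, ← coe_two_pow_mul a t] at hn'
  exact add_right_cancel (hn'.trans hm'.symm)

end ThompsonT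

/-! ### Elements of `T` with prescribed germs -/

namespace ThompsonT

/-- The rotation by a dyadic point. -/
def rotation (d : UnitAddCircle) (hd : d ∈ dyadicPoints) : ThompsonT :=
  ⟨Homeomorph.addRight d, fun x => ⟨fun h => by
      simpa using add_mem_dyadicPoints h (neg_mem_dyadicPoints hd),
      fun h => add_mem_dyadicPoints h hd⟩,
    ∅, Set.finite_empty, Set.empty_subset _, fun x _ => ⟨0, Eventually.of_forall fun t => by
      simp [add_right_comm]⟩⟩

@[simp] theorem rotation_smul (d : UnitAddCircle) (hd : d ∈ dyadicPoints) (x : UnitAddCircle) :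
    rotation d hd • x = x + d := rfl

theorem hasSlopes_rotation (d : UnitAddCircle) (hd : d ∈ dyadicPoints) (x : UnitAddCircle) :
    HasSlopes (rotation d hd) x 0 0 :=
  Eventually.of_forall fun t => by simp [twoSlope_self, add_right_comm]

/-- The function with slopes `1 / 2`, `1`, `2`, `1` on the intervals between
`0`, `1 / 4`, `3 / 8`, `1 / 2`, `1`, which maps `[0, 1]` onto itself. -/
noncomputable def bendReal (t : ℝ) : ℝ := min t (max (t / 2) (max (t - 1 / 8) (2 * t - 1 / 2)))

/-- The inverse of `bendReal` on `[0, 1]`. -/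
noncomputable def unbendReal (t : ℝ) : ℝ := max t (min (2 * t) (min (t + 1 / 8) (t / 2 + 1 / 4)))

theorem bendReal_of_mem_Icc_zero {t : ℝ} (h : t ∈ Set.Icc (0 : ℝ) (1 / 4)) :
    bendReal t = t / 2 := by
  obtain ⟨h1, h2⟩ := h
  rw [bendReal, max_eq_left, min_eq_right] <;>
    first | linarith | exact max_le (by linarith) (by linarith)

theorem bendReal_of_mem_Icc_quarter {t : ℝ} (h : t ∈ Set.Icc (1 / 4 : ℝ) (3 / 8)) :
    bendReal t = t - 1 / 8 := by
  obtain ⟨h1, h2⟩ := h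
  rw [bendReal, max_eq_left (b := 2 * t - 1 / 2), max_eq_right, min_eq_right] <;> linarith

theorem bendReal_of_mem_Icc_three_eighths {t : ℝ} (h : t ∈ Set.Icc (3 / 8 : ℝ) (1 / 2)) :
    bendReal t = 2 * t - 1 / 2 := by
  obtain ⟨h1, h2⟩ := h
  rw [bendReal, max_eq_right (a := t - 1 / 8), max_eq_right, min_eq_right] <;> linarith

theorem bendReal_of_half_le {t : ℝ} (h : 1 / 2 ≤ t) : bendReal t = t :=
  min_eq_left (le_max_of_le_right (le_max_of_le_right (by linarith)))

theorem bendReal_mem_Ico {t : ℝ} (h : t ∈ Set.Ico (0 : ℝ) 1) : bendReal t ∈ Set.Ico (0 : ℝ) 1 :=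
  ⟨le_min h.1 (le_max_of_le_left (by linarith [h.1])), (min_le_left _ _).trans_lt h.2⟩

theorem unbendReal_mem_Ico {t : ℝ} (h : t ∈ Set.Ico (0 : ℝ) 1) :
    unbendReal t ∈ Set.Ico (0 : ℝ) 1 :=
  ⟨le_max_of_le_left h.1, max_lt h.2
    (min_lt_of_right_lt (min_lt_of_right_lt (by linarith [h.2])))⟩

theorem unbendReal_bendReal {t : ℝ} (h : t ∈ Set.Ico (0 : ℝ) 1) : unbendReal (bendReal t) = t := by
  obtain ⟨h1, h2⟩ := h
  rcases le_total t (1 / 4) with h3 | h3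
  · rw [bendReal_of_mem_Icc_zero ⟨h1, h3⟩, unbendReal, min_eq_left, max_eq_right] <;>
      first | linarith | exact le_min (by linarith) (by linarith)
  rcases le_total t (3 / 8) with h4 | h4
  · rw [bendReal_of_mem_Icc_quarter ⟨h3, h4⟩, unbendReal,
      min_eq_left (b := (t - 1 / 8) / 2 + 1 / 4), min_eq_right, max_eq_right] <;> linarith
  rcases le_total t (1 / 2) with h5 | h5
  · rw [bendReal_of_mem_Icc_three_eighths ⟨h4, h5⟩, unbendReal,
      min_eq_right (b := (2 * t - 1 / 2) / 2 + 1 / 4), min_eq_right, max_eq_right] <;> linarith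
  · rw [bendReal_of_half_le h5, unbendReal,
      min_eq_right (b := t / 2 + 1 / 4), min_eq_right, max_eq_left] <;> linarith

theorem bendReal_unbendReal {t : ℝ} (h : t ∈ Set.Ico (0 : ℝ) 1) : bendReal (unbendReal t) = t := by
  obtain ⟨h1, h2⟩ := h
  rcases le_total t (1 / 8) with h3 | h3
  · rw [unbendReal, min_eq_left (a := 2 * t), max_eq_right, bendReal_of_mem_Icc_zero ⟨_, _⟩] <;>
      first | linarith | exact le_min (by linarith) (by linarith)
  rcases le_total t (1 / 4) with h4 | h4
  · rw [unbendReal, min_eq_left (a := t + 1 / 8), min_eq_right, max_eq_right,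
      bendReal_of_mem_Icc_quarter ⟨_, _⟩] <;> linarith
  rcases le_total t (1 / 2) with h5 | h5
  · rw [unbendReal, min_eq_right (a := t + 1 / 8), min_eq_right, max_eq_right,
      bendReal_of_mem_Icc_three_eighths ⟨_, _⟩] <;> linarith
  · rw [unbendReal, min_eq_right (a := t + 1 / 8), min_eq_right, max_eq_left,
      bendReal_of_half_le] <;> linarith

/-- The map of the circle induced by a function on `[0, 1)`. -/
noncomputable def circleMap (f : ℝ → ℝ) : UnitAddCircle → UnitAddCircle :=
  AddCircle.liftIco 1 0 fun t => (f t : UnitAddCircle)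

theorem circleMap_coe (f : ℝ → ℝ) {t : ℝ} (ht : t ∈ Set.Ico (0 : ℝ) 1) :
    circleMap f t = f t :=
  AddCircle.liftIco_zero_coe_apply ht

theorem continuous_circleMap {f : ℝ → ℝ} (hf : Continuous f) (h0 : f 0 = 0) (h1 : f 1 = 1) :
    Continuous (circleMap f) := by
  refine AddCircle.liftIco_zero_continuous ?_ ?_
  · rw [h0, h1, AddCircle.coe_zero, AddCircle.coe_period]
  · exact ((AddCircle.continuous_mk' (1 : ℝ)).comp hf).continuousOn

theorem leftInverse_circleMap {f g : ℝ → ℝ}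
    (hf : ∀ t ∈ Set.Ico (0 : ℝ) 1, f t ∈ Set.Ico (0 : ℝ) 1)
    (hgf : ∀ t ∈ Set.Ico (0 : ℝ) 1, g (f t) = t) :
    Function.LeftInverse (circleMap g) (circleMap f) := by
  intro x
  obtain ⟨t, ht, rfl⟩ := AddCircle.eq_coe_Ico x
  rw [circleMap_coe f ht, circleMap_coe g (hf t ht), hgf t ht]

/-- The homeomorphism of the circle induced by `bendReal`. -/
noncomputable def bendHomeomorph : UnitAddCircle ≃ₜ UnitAddCircle where
  toFun := circleMap bendReal
  invFun := circleMap unbendReal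
  left_inv := leftInverse_circleMap (fun _ => bendReal_mem_Ico) fun _ => unbendReal_bendReal
  right_inv := leftInverse_circleMap (fun _ => unbendReal_mem_Ico) fun _ => bendReal_unbendReal
  continuous_toFun := continuous_circleMap (by unfold bendReal; fun_prop)
    (by norm_num [bendReal]) (by norm_num [bendReal])
  continuous_invFun := continuous_circleMap (by unfold unbendReal; fun_prop)
    (by norm_num [unbendReal]) (by norm_num [unbendReal])

theorem coe_bendReal_mem_dyadicPoints {t : ℝ} (h : (t : UnitAddCircle) ∈ dyadicPoints) :
    (bendReal t : UnitAddCircle) ∈ dyadicPoints := by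
  have h1 : ((t / 2 : ℝ) : UnitAddCircle) ∈ dyadicPoints := coe_half_mem_dyadicPoints h
  have h2 : ((t - 1 / 8 : ℝ) : UnitAddCircle) ∈ dyadicPoints := by
    rw [sub_eq_add_neg, AddCircle.coe_add]
    exact add_mem_dyadicPoints h ⟨-1, 3, by norm_num⟩
  have h3 : ((2 * t - 1 / 2 : ℝ) : UnitAddCircle) ∈ dyadicPoints := by
    rw [sub_eq_add_neg, AddCircle.coe_add]
    exact add_mem_dyadicPoints (coe_double_mem_dyadicPoints h) ⟨-1, 1, by norm_num⟩
  unfold bendReal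
  rcases min_choice t (max (t / 2) (max (t - 1 / 8) (2 * t - 1 / 2))) with e | e <;> rw [e]
  · exact h
  rcases max_choice (t / 2) (max (t - 1 / 8) (2 * t - 1 / 2)) with e | e <;> rw [e]
  · exact h1
  rcases max_choice (t - 1 / 8) (2 * t - 1 / 2) with e | e <;> rw [e]
  exacts [h2, h3]

theorem coe_unbendReal_mem_dyadicPoints {t : ℝ} (h : (t : UnitAddCircle) ∈ dyadicPoints) :
    (unbendReal t : UnitAddCircle) ∈ dyadicPoints := by
  have h1 : ((2 * t : ℝ) : UnitAddCircle) ∈ dyadicPoints := coe_double_mem_dyadicPoints h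
  have h2 : ((t + 1 / 8 : ℝ) : UnitAddCircle) ∈ dyadicPoints := by
    rw [AddCircle.coe_add]
    exact add_mem_dyadicPoints h ⟨1, 3, by norm_num⟩
  have h3 : ((t / 2 + 1 / 4 : ℝ) : UnitAddCircle) ∈ dyadicPoints := by
    rw [AddCircle.coe_add]
    exact add_mem_dyadicPoints (coe_half_mem_dyadicPoints h) ⟨1, 2, by norm_num⟩
  unfold unbendReal
  rcases max_choice t (min (2 * t) (min (t + 1 / 8) (t / 2 + 1 / 4))) with e | e <;> rw [e]
  · exact h
  rcases min_choice (2 * t) (min (t + 1 / 8) (t / 2 + 1 / 4)) with e | e <;> rw [e]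
  · exact h1
  rcases min_choice (t + 1 / 8) (t / 2 + 1 / 4) with e | e <;> rw [e]
  exacts [h2, h3]

/-- An affine piece of `bendReal` is an affine piece of the homeomorphism of the circle. -/
theorem bendHomeomorph_coe_add {a b c : ℝ} {k : ℤ} (ha : 0 ≤ a) (hb : b ≤ 1)
    (h : ∀ t ∈ Set.Ioo a b, bendReal t = 2 ^ k * t + c) {t : ℝ} (ht : t ∈ Set.Ioo a b) :
    ∀ᶠ s : ℝ in 𝓝 0, bendHomeomorph ((t : UnitAddCircle) + (s : UnitAddCircle)) =
      bendHomeomorph (t : UnitAddCircle) + (((2 : ℝ) ^ k * s : ℝ) : UnitAddCircle) := by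
  have hc : Tendsto (fun s : ℝ => t + s) (𝓝 0) (𝓝 t) := by
    simpa using (continuous_const_add t).tendsto 0
  have hI (s : ℝ) (hs : s ∈ Set.Ioo a b) : s ∈ Set.Ico (0 : ℝ) 1 :=
    ⟨ha.trans hs.1.le, hs.2.trans_le hb⟩
  filter_upwards [hc.eventually (Ioo_mem_nhds ht.1 ht.2)] with s hs
  change circleMap bendReal _ = circleMap bendReal _ + _
  rw [← AddCircle.coe_add, circleMap_coe _ (hI _ hs), circleMap_coe _ (hI _ ht), h _ hs, h _ ht,
    ← AddCircle.coe_add]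
  congr 1
  ring

/-- The element of `T` given by `bendReal`. Together with the dyadic rotations it realizes
all germs of elements of `T`. -/
noncomputable def bend : ThompsonT :=
  ⟨bendHomeomorph, by
    intro x
    obtain ⟨t, ht, rfl⟩ := AddCircle.eq_coe_Ico x
    have e : bendHomeomorph (t : UnitAddCircle) = bendReal t := circleMap_coe _ ht
    rw [e]
    refine ⟨fun h => ?_, coe_bendReal_mem_dyadicPoints⟩
    have := coe_unbendReal_mem_dyadicPoints h
    rwa [unbendReal_bendReal ht] at this,
    {((0 : ℝ) : UnitAddCircle), ((1 / 4 : ℝ) : UnitAddCircle), ((3 / 8 : ℝ) : UnitAddCircle),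
      ((1 / 2 : ℝ) : UnitAddCircle)}, by simp, by
    rintro x (rfl | rfl | rfl | rfl)
    exacts [⟨0, 0, by norm_num⟩, ⟨1, 2, by norm_num⟩, ⟨3, 3, by norm_num⟩, ⟨1, 1, by norm_num⟩], by
    intro x hx
    obtain ⟨t, ht, rfl⟩ := AddCircle.eq_coe_Ico x
    simp only [Set.mem_insert_iff, Set.mem_singleton_iff, not_or] at hx
    obtain ⟨n0, n1, n2, n3⟩ := hx
    have n0 : 0 < t := lt_of_le_of_ne ht.1 fun h => n0 (h ▸ rfl)
    rcases lt_trichotomy t (1 / 4) with h1 | h1 | h1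
    · exact ⟨-1, bendHomeomorph_coe_add (c := 0) (a := 0) (b := 1 / 4) (by norm_num) (by norm_num)
        (fun s hs => by rw [bendReal_of_mem_Icc_zero ⟨hs.1.le, hs.2.le⟩]; norm_num; ring) ⟨n0, h1⟩⟩
    · exact absurd (congrArg _ h1) n1
    rcases lt_trichotomy t (3 / 8) with h2 | h2 | h2
    · exact ⟨0, bendHomeomorph_coe_add (c := -1 / 8) (a := 1 / 4) (b := 3 / 8) (by norm_num)
        (by norm_num) (fun s hs => by
          rw [bendReal_of_mem_Icc_quarter ⟨hs.1.le, hs.2.le⟩]; norm_num; ring) ⟨h1, h2⟩⟩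
    · exact absurd (congrArg _ h2) n2
    rcases lt_trichotomy t (1 / 2) with h3 | h3 | h3
    · exact ⟨1, bendHomeomorph_coe_add (c := -1 / 2) (a := 3 / 8) (b := 1 / 2) (by norm_num)
        (by norm_num) (fun s hs => by
          rw [bendReal_of_mem_Icc_three_eighths ⟨hs.1.le, hs.2.le⟩]; norm_num; ring) ⟨h2, h3⟩⟩
    · exact absurd (congrArg _ h3) n3
    · exact ⟨0, bendHomeomorph_coe_add (c := 0) (a := 1 / 2) (b := 1) (by norm_num) le_rfl
        (fun s hs => by rw [bendReal_of_half_le hs.1.le]; simp) ⟨h3, ht.2⟩⟩⟩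

theorem bend_smul_coe {t : ℝ} (ht : t ∈ Set.Ico (0 : ℝ) 1) :
    bend • (t : UnitAddCircle) = bendReal t :=
  circleMap_coe _ ht

theorem bend_smul_zero : bend • (0 : UnitAddCircle) = 0 := by
  have := bend_smul_coe (t := 0) (by norm_num)
  rw [bendReal_of_mem_Icc_zero (by norm_num)] at this
  simpa using this

theorem hasSlopes_bend_zero : HasSlopes bend 0 0 (-1) := by
  filter_upwards [Ioo_mem_nhds (by norm_num : (-1 / 2 : ℝ) < 0) (by norm_num : (0 : ℝ) < 1 / 4)]
    with t ht
  rw [bend_smul_zero, zero_add, zero_add]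
  rcases lt_or_ge t 0 with h | h
  · rw [twoSlope_of_nonpos _ _ h.le, ← AddCircle.coe_add_period (1 : ℝ) t,
      bend_smul_coe ⟨by linarith [ht.1], by linarith⟩, bendReal_of_half_le (by linarith [ht.1]),
      AddCircle.coe_add_period]
    simp
  · rw [twoSlope_of_nonneg _ _ h, bend_smul_coe ⟨h, by linarith [ht.2]⟩,
      bendReal_of_mem_Icc_zero ⟨h, ht.2.le⟩]
    congr 1
    norm_num
    ring

theorem bend_smul_half : bend • ((1 / 2 : ℝ) : UnitAddCircle) = ((1 / 2 : ℝ) : UnitAddCircle) := by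
  rw [bend_smul_coe (by norm_num), bendReal_of_half_le le_rfl]

theorem hasSlopes_bend_half : HasSlopes bend ((1 / 2 : ℝ) : UnitAddCircle) 1 0 := by
  filter_upwards [Ioo_mem_nhds (by norm_num : (-1 / 8 : ℝ) < 0) (by norm_num : (0 : ℝ) < 1 / 2)]
    with t ht
  rw [bend_smul_half, ← AddCircle.coe_add,
    bend_smul_coe ⟨by linarith [ht.1], by linarith [ht.2]⟩, ← AddCircle.coe_add]
  congr 1
  rcases le_total t 0 with h | h
  · rw [twoSlope_of_nonpos _ _ h,
      bendReal_of_mem_Icc_three_eighths ⟨by linarith [ht.1], by linarith⟩]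
    norm_num
    ring
  · rw [twoSlope_of_nonneg _ _ h, bendReal_of_half_le (by linarith)]
    simp

theorem hasSlopes_bend_coe {t : ℝ} (ht : t ∈ Set.Ioo (0 : ℝ) (1 / 4)) :
    HasSlopes bend (t : UnitAddCircle) (-1) (-1) := by
  refine (bendHomeomorph_coe_add (c := 0) (k := -1) le_rfl (by norm_num) (fun s hs => ?_) ht).mono
    fun s hs => ?_
  · rw [bendReal_of_mem_Icc_zero ⟨hs.1.le, hs.2.le⟩]
    norm_num
    ring
  · rw [twoSlope_self]
    exact hs

theorem half_mem_dyadicPoints : ((1 / 2 : ℝ) : UnitAddCircle) ∈ dyadicPoints :=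
  ⟨1, 1, by norm_num⟩

/-- The subgroup generated by the dyadic rotations and `bend`. -/
noncomputable def bendSubgroup : Subgroup ThompsonT :=
  Subgroup.closure (Set.range fun o : Option dyadicPoints =>
    o.elim bend fun d => rotation d d.2)

theorem countable_bendSubgroup : (bendSubgroup : Set ThompsonT).Countable := by
  have := countable_dyadicPoints.to_subtype
  have hF : Countable (FreeGroup (Option dyadicPoints)) :=
    inferInstanceAs (Countable (Quot _))
  rw [bendSubgroup, ← FreeGroup.range_lift_eq_closure, MonoidHom.coe_range]
  exact Set.countable_range _

theorem bend_mem : bend ∈ bendSubgroup := Subgroup.subset_closure ⟨none, rfl⟩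

theorem rotation_mem (d : UnitAddCircle) (hd : d ∈ dyadicPoints) : rotation d hd ∈ bendSubgroup :=
  Subgroup.subset_closure ⟨some ⟨d, hd⟩, rfl⟩

theorem HasSlopes.pow_of_smul_eq {g : ThompsonT} {x : UnitAddCircle} {k l : ℤ}
    (hg : HasSlopes g x k l) (hx : g • x = x) (n : ℕ) :
    g ^ n • x = x ∧ HasSlopes (g ^ n) x (n * k) (n * l) := by
  induction n with
  | zero => simpa using HasSlopes.one x
  | succ n ih =>
    rw [pow_succ]
    refine ⟨by rw [mul_smul, hx, ih.1], ?_⟩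
    convert HasSlopes.mul (by rw [hx]; exact ih.2) hg using 1 <;> push_cast <;> ring

/-- The generators realize all pairs of nonpositive slopes for germs from `0` to a dyadic point. -/
theorem exists_hasSlopes_zero {x : UnitAddCircle} (hx : x ∈ dyadicPoints) (p : ℕ × ℕ) :
    ∃ h ∈ bendSubgroup, h • (0 : UnitAddCircle) = x ∧ HasSlopes h 0 (-p.1) (-p.2) := by
  set ρ := rotation _ half_mem_dyadicPoints
  have hρ : ((1 / 2 : ℝ) : UnitAddCircle) + ((1 / 2 : ℝ) : UnitAddCircle) = 0 := by
    rw [← AddCircle.coe_add, add_halves, AddCircle.coe_period]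
  -- Conjugating the inverse of `bend` by the half turn moves its left slope at `1 / 2` to `0`.
  set lam := ρ * bend⁻¹ * ρ with hlam
  have e1 : ρ • (0 : UnitAddCircle) = ((1 / 2 : ℝ) : UnitAddCircle) := by
    rw [rotation_smul, zero_add]
  have e2 : bend⁻¹ • ((1 / 2 : ℝ) : UnitAddCircle) = ((1 / 2 : ℝ) : UnitAddCircle) := by
    rw [inv_smul_eq_iff, bend_smul_half]
  have e3 : ρ • ((1 / 2 : ℝ) : UnitAddCircle) = 0 := by
    rw [rotation_smul, hρ]
  have hl0 : lam • (0 : UnitAddCircle) = 0 := by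
    rw [hlam, mul_smul, mul_smul, e1, e2, e3]
  have hl : HasSlopes lam 0 (-1) 0 := by
    have h1 := hasSlopes_bend_half.inv
    rw [bend_smul_half] at h1
    have h2 := (hasSlopes_rotation _ half_mem_dyadicPoints _).mul h1
    have h3 := HasSlopes.mul (g := ρ) (by rw [e1]; exact h2)
      (hasSlopes_rotation _ half_mem_dyadicPoints 0)
    rwa [zero_add, zero_add, neg_zero, add_zero, add_zero] at h3
  obtain ⟨f1, s1⟩ := hl.pow_of_smul_eq hl0 p.1
  obtain ⟨f2, s2⟩ := hasSlopes_bend_zero.pow_of_smul_eq bend_smul_zero p.2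
  have hρm := rotation_mem _ half_mem_dyadicPoints
  refine ⟨rotation x hx * (lam ^ p.1 * bend ^ p.2), ?_, ?_, ?_⟩
  · exact mul_mem (rotation_mem x hx) (mul_mem (pow_mem (mul_mem (mul_mem hρm
      (inv_mem bend_mem)) hρm) _) (pow_mem bend_mem _))
  · rw [mul_smul, mul_smul, f2, f1, rotation_smul, zero_add]
  · have h1 := HasSlopes.mul (by rw [f2]; exact s1) s2
    simpa using (hasSlopes_rotation x hx _).mul h1

/-- The generators realize the local inverses of the doubling map. -/
theorem exists_hasSlopes_two_smul (x : UnitAddCircle) :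
    ∃ h ∈ bendSubgroup, h • (2 • x) = x ∧ HasSlopes h (2 • x) (-1) (-1) := by
  obtain ⟨r, rfl⟩ := QuotientAddGroup.mk_surjective x
  obtain ⟨q, hq1, hq2, hq⟩ := exists_dyadic_btwn (by linarith : 2 * r - 1 / 4 < 2 * r)
  have hmem : 2 * r - q ∈ Set.Ioo (0 : ℝ) (1 / 4) := ⟨by linarith, by linarith⟩
  have e0 : rotation _ (neg_mem_dyadicPoints hq) • ((2 * r : ℝ) : UnitAddCircle) =
      ((2 * r - q : ℝ) : UnitAddCircle) := by
    rw [rotation_smul, AddCircle.coe_sub, sub_eq_add_neg]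
  have e : (2 • (QuotientAddGroup.mk r : UnitAddCircle)) = ((2 * r : ℝ) : UnitAddCircle) := by
    rw [two_smul, two_mul]
    rfl
  rw [e]
  refine ⟨rotation _ (coe_half_mem_dyadicPoints hq) * (bend * rotation _ (neg_mem_dyadicPoints hq)),
    mul_mem (rotation_mem _ _) (mul_mem bend_mem (rotation_mem _ _)), ?_, ?_⟩
  · rw [mul_smul, mul_smul, e0, bend_smul_coe ⟨hmem.1.le, by linarith [hmem.2]⟩,
      bendReal_of_mem_Icc_zero ⟨hmem.1.le, hmem.2.le⟩, rotation_smul, ← AddCircle.coe_add]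
    congr 1
    ring
  · have h1 := HasSlopes.mul (by rw [e0]; exact hasSlopes_bend_coe hmem)
      (hasSlopes_rotation _ (neg_mem_dyadicPoints hq) _)
    simpa using (hasSlopes_rotation _ (coe_half_mem_dyadicPoints hq) _).mul h1

theorem exists_hasSlopes_two_pow_smul (i : ℕ) (x : UnitAddCircle) :
    ∃ h ∈ bendSubgroup, h • ((2 ^ i) • x) = x ∧ HasSlopes h ((2 ^ i) • x) (-i) (-i) := by
  induction i with
  | zero => exact ⟨1, one_mem _, by simp, by simpa using HasSlopes.one _⟩
  | succ i ih =>
    obtain ⟨h, hm, h1, h2⟩ := ih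
    obtain ⟨k, km, k1, k2⟩ := exists_hasSlopes_two_smul ((2 ^ i) • x)
    rw [pow_succ', mul_smul]
    refine ⟨h * k, mul_mem hm km, by rw [mul_smul, k1, h1], ?_⟩
    convert HasSlopes.mul (by rw [k1]; exact h2) k2 using 1 <;> push_cast <;> ring

end ThompsonT

/-! ### The approximately invariant means -/

namespace GroupoidOver

variable {G X : Type*} [GroupoidOver G X]

theorem unit_mul_of_eq (x : X) (h : G) (e : s (unit x : G) = r h) : mul (unit x) h e = h := by
  obtain rfl : x = r h := (s_unit x).symm.trans e
  exact unit_mul h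

theorem mul_eq_iff_eq_inv_mul {g a h : G} (e : s g = r a) (e' : s (inv g) = r h) :
    mul g a e = h ↔ a = mul (inv g) h e' := by
  constructor
  · rintro rfl
    rw [← mul_assoc (inv g) g a (s_inv g) e]
    simp only [inv_mul, unit_mul_of_eq]
  · rintro rfl
    rw [← mul_assoc g (inv g) h (r_inv g).symm e']
    simp only [mul_inv, unit_mul_of_eq]

end GroupoidOver

namespace ThompsonT

open GermGroupoid

/-- The germ at `2 ^ i • x` of the local inverse of the `i`-fold doubling map that takes
`2 ^ i • x` to `x`. -/
noncomputable def undoubling (i : ℕ) (x : UnitAddCircle) : GermGroupoid ThompsonT UnitAddCircle :=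
  mk (exists_hasSlopes_two_pow_smul i x).choose ((2 ^ i) • x)

theorem continuous_undoubling (i : ℕ) : Continuous (undoubling i) := by
  refine continuous_iff_continuousAt.2 fun x => ?_
  obtain ⟨-, h1, h2⟩ := (exists_hasSlopes_two_pow_smul i x).choose_spec
  set h := (exists_hasSlopes_two_pow_smul i x).choose
  -- The element chosen at `x` serves all points near `x`.
  have hev : ∀ᶠ y in 𝓝 x, mk h ((2 ^ i) • y) = undoubling i y := by
    refine eventually_nhds_iff_add_coe.2 ?_
    have hc : Tendsto (fun t : ℝ => 2 ^ i * t) (𝓝 0) (𝓝 0) := by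
      simpa using (continuous_const_mul ((2 : ℝ) ^ i)).tendsto 0
    have key (t : ℝ) : (2 ^ i) • (x + (t : UnitAddCircle)) =
        (2 ^ i) • x + ((2 ^ i * t : ℝ) : UnitAddCircle) := by
      rw [smul_add, coe_two_pow_mul]
    filter_upwards [hc.eventually (eventually_eventually_nhds.2 h2)] with t ht
    have hpow : (2 : ℝ) ^ (-(i : ℤ)) * 2 ^ i = 1 := by
      rw [zpow_neg, zpow_natCast, inv_mul_cancel₀ (by positivity)]
    have e : h • ((2 ^ i) • (x + (t : UnitAddCircle))) = x + (t : UnitAddCircle) := by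
      rw [key, ht.self_of_nhds, h1, twoSlope_self, ← mul_assoc, hpow, one_mul]
    obtain ⟨-, k1, k2⟩ := (exists_hasSlopes_two_pow_smul i (x + (t : UnitAddCircle))).choose_spec
    refine HasSlopes.mk_eq_mk ?_ k2 (e.trans k1.symm)
    have hs : Tendsto (fun s : ℝ => 2 ^ i * t + s) (𝓝 0) (𝓝 (2 ^ i * t)) := by
      simpa using (continuous_const_add ((2 : ℝ) ^ i * t)).tendsto 0
    filter_upwards [hs.eventually ht] with s hst
    rw [e, key, add_assoc, ← AddCircle.coe_add, hst, h1, twoSlope_self, twoSlope_self, mul_add,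
      AddCircle.coe_add, ← mul_assoc, hpow, one_mul, add_assoc]
  refine ContinuousAt.congr ?_ hev
  exact ((continuous_mk h).comp (continuous_nsmul (2 ^ i))).continuousAt

open Classical in
/-- A family of germs with range `x` indexed by `ℕ²`. For dyadic `x`, these are the germs from `0`
to `x` with nonpositive slope exponents. For other `x`, these are the germs of the local inverses
of the iterated doubling maps, and the second index plays no role. -/
noncomputable def ray (p : ℕ × ℕ) (x : UnitAddCircle) : GermGroupoid ThompsonT UnitAddCircle :=
  if hx : x ∈ dyadicPoints then mk (exists_hasSlopes_zero hx p).choose 0 else undoubling p.1 x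

theorem ray_eq_mk_of_mem {x : UnitAddCircle} (hx : x ∈ dyadicPoints) (p : ℕ × ℕ) :
    ∃ h ∈ bendSubgroup, ray p x = mk h 0 ∧ h • (0 : UnitAddCircle) = x ∧
      HasSlopes h 0 (-p.1) (-p.2) := by
  obtain ⟨hm, h1, h2⟩ := (exists_hasSlopes_zero hx p).choose_spec
  exact ⟨_, hm, dif_pos hx, h1, h2⟩

theorem ray_eq_mk_of_notMem {x : UnitAddCircle} (hx : x ∉ dyadicPoints) (p : ℕ × ℕ) :
    ∃ h ∈ bendSubgroup, ray p x = mk h ((2 ^ p.1) • x) ∧ h • ((2 ^ p.1) • x) = x ∧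
      HasSlopes h ((2 ^ p.1) • x) (-p.1) (-p.1) := by
  obtain ⟨hm, h1, h2⟩ := (exists_hasSlopes_two_pow_smul p.1 x).choose_spec
  exact ⟨_, hm, dif_neg hx, h1, h2⟩

theorem ray_eq_mk (p : ℕ × ℕ) (x : UnitAddCircle) :
    ∃ h ∈ bendSubgroup, ∃ z, ray p x = mk h z ∧ h • z = x := by
  by_cases hx : x ∈ dyadicPoints
  · obtain ⟨h, hm, h1, h2, -⟩ := ray_eq_mk_of_mem hx p
    exact ⟨h, hm, _, h1, h2⟩
  · obtain ⟨h, hm, h1, h2, -⟩ := ray_eq_mk_of_notMem hx p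
    exact ⟨h, hm, _, h1, h2⟩

theorem rng_ray (p : ℕ × ℕ) (x : UnitAddCircle) : rng (ray p x) = x := by
  obtain ⟨h, -, z, h1, h2⟩ := ray_eq_mk p x
  rw [h1, rng_mk, h2]

/-- Left multiplication by a germ from `x` to `y` takes the rays at `x` to the rays at `y`, up to
a translation of the index, far enough out. Dyadic `x`: the slope exponents translate the index.
Other `x`: the forward orbits of `x` and `y` under doubling merge. -/
theorem exists_prod_ray (γ : GermGroupoid ThompsonT UnitAddCircle) :
    ∃ a b : ℕ × ℕ, ∀ p, prod γ (ray (a + p) (src γ)) (rng_ray _ _).symm = ray (b + p) (rng γ) := by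
  induction γ using ind with | h g x
  have hprod (p : ℕ × ℕ) {h : ThompsonT} {z : UnitAddCircle} (e : ray p x = mk h z) :
      prod (mk g x) (ray p x) (rng_ray _ _).symm = mk (g * h) z := by
    have : ∀ (β : GermGroupoid ThompsonT UnitAddCircle) (hβ : src (mk g x) = rng β),
        β = mk h z → prod (mk g x) β hβ = mk (g * h) z := by
      rintro _ hβ rfl
      exact prod_mk_mk g h x z hβ
    exact this _ _ e
  simp only [src_mk, rng_mk]
  by_cases hx : x ∈ dyadicPoints
  · obtain ⟨k, l, hkl⟩ := exists_hasSlopes g x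
    refine ⟨(k.toNat, l.toNat), ((-k).toNat, (-l).toNat), fun p => ?_⟩
    obtain ⟨h, -, h1, h2, h3⟩ := ray_eq_mk_of_mem hx ((k.toNat, l.toNat) + p)
    obtain ⟨h', -, h1', h2', h3'⟩ := ray_eq_mk_of_mem ((smul_mem_dyadicPoints_iff g x).2 hx)
      (((-k).toNat, (-l).toNat) + p)
    rw [hprod _ h1, h1']
    refine HasSlopes.mk_eq_mk (HasSlopes.mul (by rw [h2]; exact hkl) h3) ?_ (by
      rw [mul_smul, h2, h2'])
    convert h3' using 1 <;> simp only [Prod.fst_add, Prod.snd_add, Nat.cast_add] <;> omega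
  · obtain ⟨k, hk⟩ := exists_hasSlopes_self g hx
    obtain ⟨a, b, hab, horb⟩ := hk.exists_two_pow_smul_eq
    refine ⟨(a, 0), (b, 0), fun p => ?_⟩
    obtain ⟨h, -, h1, h2, h3⟩ := ray_eq_mk_of_notMem hx ((a, 0) + p)
    obtain ⟨h', -, h1', h2', h3'⟩ := ray_eq_mk_of_notMem
      (fun hd => hx ((smul_mem_dyadicPoints_iff g x).1 hd)) ((b, 0) + p)
    rw [hprod _ h1, h1']
    have e : (2 ^ ((b, 0) + p).1) • g • x = (2 ^ ((a, 0) + p).1) • x := (horb p.1).symm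
    rw [e] at h2' h3' ⊢
    refine HasSlopes.mk_eq_mk (HasSlopes.mul (by rw [h2]; exact hk) h3) ?_ (by
      rw [mul_smul]
      exact (congrArg _ h2).trans h2'.symm)
    convert h3' using 1 <;> simp only [Prod.fst_add, Nat.cast_add] <;> omega

/-- Every germ is a quotient of two rays, and rays are germs of elements of `bendSubgroup`. -/
theorem exists_mem_bendSubgroup_mk_eq (g : ThompsonT) (x : UnitAddCircle) :
    ∃ k ∈ bendSubgroup, mk g x = mk k x := by
  obtain ⟨a, b, h⟩ := exists_prod_ray (mk g x)
  obtain ⟨u, hu, z, e, hz⟩ := ray_eq_mk (a + 0) x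
  obtain ⟨v, hv, w, f, -⟩ := ray_eq_mk (b + 0) (g • x)
  refine ⟨v * u⁻¹, mul_mem hv (inv_mem hu), ?_⟩
  have h0 : mk (g * u) z = mk v w := by
    rw [← f, ← rng_mk, ← h 0, ← prod_mk_mk g u x z hz.symm]
    congr 1
    exact e.symm
  obtain ⟨rfl, hgu⟩ := mk_eq_mk.1 h0
  subst hz
  have hc : Tendsto (fun y : UnitAddCircle => u⁻¹ • y) (𝓝 (u • z)) (𝓝 z) := by
    simpa using (continuous_const_smul (T := UnitAddCircle) u⁻¹).tendsto (u • z)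
  refine mk_eq_mk.2 ⟨rfl, (hc.eventually hgu).mono fun y hy => ?_⟩
  simpa [mul_smul] using hy

open Classical in
/-- The mass at `h` of the average of the point masses at the rays with range `x` over the box of
side `n + 1`. -/
noncomputable def boxMean (n : ℕ) (x : UnitAddCircle) (h : GermGroupoid ThompsonT UnitAddCircle) :
    ℝ :=
  ∑ p ∈ box (n + 1), if ray p x = h then ((n : ℝ) + 1)⁻¹ ^ 2 else 0

theorem hasSum_mul_boxMean (n : ℕ) (x : UnitAddCircle)
    (f : GermGroupoid ThompsonT UnitAddCircle → ℝ) :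
    HasSum (fun g : {g : GermGroupoid ThompsonT UnitAddCircle // rng g = x} =>
      f g * boxMean n x g) (∑ p ∈ box (n + 1), f (ray p x) * ((n : ℝ) + 1)⁻¹ ^ 2) := by
  classical
  convert hasSum_sum_pointMass (box (n + 1))
    (fun p => (⟨ray p x, rng_ray p x⟩ : {g : GermGroupoid ThompsonT UnitAddCircle // rng g = x}))
    (((n : ℝ) + 1)⁻¹ ^ 2) (fun g => f g) using 2 with g
  simp only [boxMean, Subtype.ext_iff]

theorem measurable_ray (p : ℕ × ℕ) {f : GermGroupoid ThompsonT UnitAddCircle → ℝ}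
    (hf : Measurable[borel _] f) : Measurable[borel _] fun x => f (ray p x) := by
  borelize UnitAddCircle (GermGroupoid ThompsonT UnitAddCircle)
  refine (hf.comp (continuous_undoubling p.1).measurable).measurable_of_countable_ne ?_
  refine countable_dyadicPoints.mono fun x hx => ?_
  by_contra hd
  exact hx (by simp [ray, hd])

theorem isBorelAmenable_germGroupoid :
    IsBorelAmenable (GermGroupoid ThompsonT UnitAddCircle) UnitAddCircle := by
  classical
  refine ⟨boxMean, fun n x g => ?_, fun n x g hg => ?_, fun n x => ?_, fun n f hf _ => ?_,
    fun g => ?_⟩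
  · exact Finset.sum_nonneg fun p _ => by positivity
  · refine Finset.sum_eq_zero fun p _ => if_neg ?_
    rintro rfl
    exact hg (rng_ray p x)
  · have h := hasSum_mul_boxMean n x fun _ => 1
    have hn : (n : ℝ) + 1 ≠ 0 := by positivity
    simp only [one_mul, Finset.sum_const, nsmul_eq_mul, card_box] at h
    rw [← mul_pow, Nat.cast_succ, mul_inv_cancel₀ hn, one_pow] at h
    exact h
  · have (x : UnitAddCircle) := (hasSum_mul_boxMean n x f).tsum_eq
    change Measurable[borel _] fun x => 
      ∑' g : {g : GermGroupoid ThompsonT UnitAddCircle // rng g = x}, f g * boxMean n x g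
    simp_rw [this]
    borelize UnitAddCircle
    exact Finset.measurable_sum _ fun p _ => (measurable_ray p hf).mul_const _
  · obtain ⟨a, b, hab⟩ := exists_prod_ray g
    let u (p : ℕ × ℕ) : {h : GermGroupoid ThompsonT UnitAddCircle //
        GroupoidOver.r h = GroupoidOver.r g} :=
      ⟨GroupoidOver.mul g (ray p (src g)) (rng_ray _ _).symm, GroupoidOver.r_mul _ _ _⟩
    let v (p : ℕ × ℕ) : {h : GermGroupoid ThompsonT UnitAddCircle //
        GroupoidOver.r h = GroupoidOver.r g} :=
      ⟨ray p (rng g), rng_ray _ _⟩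
    have hmain := tendsto_tsum_abs_sub_box u v a b fun p => Subtype.ext (hab p)
    convert hmain using 6 with n h
    · refine Finset.sum_congr rfl fun p _ => if_congr ?_ rfl rfl
      rw [Subtype.ext_iff]
      exact (GroupoidOver.mul_eq_iff_eq_inv_mul _ _).symm
    · simp [boxMean, v, Subtype.ext_iff]
      rfl

/-! ### Nonseparated germs -/

/-- The germs of `bend` and of the identity agree at all points on the left of `0` and near `0`,
but not at `0`. -/
theorem not_t2Space_germGroupoid : ¬ T2Space (GermGroupoid ThompsonT UnitAddCircle) := by
  intro _
  have hcoe : Continuous ((↑) : ℝ → UnitAddCircle) := AddCircle.continuous_mk' 1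
  have hl (g : ThompsonT) : Tendsto (fun t : ℝ => mk g (t : UnitAddCircle)) (𝓝[<] 0)
      (𝓝 (mk g (0 : UnitAddCircle))) :=
    (((continuous_mk g).comp hcoe).tendsto 0).mono_left nhdsWithin_le_nhds
  have hev : ∀ᶠ t : ℝ in 𝓝[<] 0, mk bend (t : UnitAddCircle) = mk 1 (t : UnitAddCircle) := by
    have h1 := eventually_eventually_nhds.2 hasSlopes_bend_zero
    filter_upwards [nhdsWithin_le_nhds h1, self_mem_nhdsWithin] with t ht h0
    refine mk_eq_mk.2 ⟨rfl, eventually_nhds_iff_add_coe.2 ?_⟩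
    have hc : Tendsto (fun s : ℝ => t + s) (𝓝 0) (𝓝 t) := by
      simpa using (continuous_const_add t).tendsto 0
    filter_upwards [hc.eventually (ht.and (gt_mem_nhds h0))] with s hs
    have h2 := hs.1
    rw [twoSlope_of_nonpos _ _ hs.2.le, bend_smul_zero, zero_add, zero_add, zpow_zero,
      one_mul] at h2
    rw [← AddCircle.coe_add, h2, one_smul]
  have h0 : mk bend (0 : UnitAddCircle) = mk 1 (0 : UnitAddCircle) :=
    tendsto_nhds_unique_of_eventuallyEq (hl bend) (hl 1) hev
  have h1 := eventually_nhds_iff_add_coe.1 (mk_eq_mk.1 h0).2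
  have h2 : (2 : ℝ)⁻¹ - 1 = 0 := by
    refine eq_zero_of_eventually_coe_mul_eq_zero ?_
    filter_upwards [nhdsWithin_le_nhds h1, nhdsWithin_le_nhds hasSlopes_bend_zero,
      self_mem_nhdsWithin] with t h1 h2 h3
    have h3 : 0 < t := h3
    rw [h2, twoSlope_of_nonneg _ _ h3.le, bend_smul_zero, one_smul, zero_add, zero_add] at h1
    rw [sub_mul, AddCircle.coe_sub, one_mul, ← h1]
    simp
  norm_num at h2

end ThompsonT

theorem mainTheorem4 :
    IsEtaleGroupoid (GermGroupoid ThompsonT UnitAddCircle) UnitAddCircle ∧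
    SecondCountableTopology (GermGroupoid ThompsonT UnitAddCircle) ∧
    ¬ T2Space (GermGroupoid ThompsonT UnitAddCircle) ∧
    IsBorelAmenable (GermGroupoid ThompsonT UnitAddCircle) UnitAddCircle :=
  ⟨GermGroupoid.isEtaleGroupoid,
    GermGroupoid.secondCountableTopology_of_countable_cover ThompsonT.countable_bendSubgroup
      ThompsonT.exists_mem_bendSubgroup_mk_eq,
    ThompsonT.not_t2Space_germGroupoid,
    ThompsonT.isBorelAmenable_germGroupoid⟩
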